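/- **Theorem.** Let $A>0$, $k>0$ and $\alpha>1$. For $N\in\mathbb N$ consider the system formed by one leader with position $p_l(t)\in\mathbb R^2$, controlled by an input $u(t)=(u_x(t),u_y(t))$, and $N$ followers with positions $p^i(t)=(x^i(t),y^i(t))$ and velocities $v^i(t)=(v^i_x(t),v^i_y(t))$, $i=1,\dots,N$: $$\dot p_l=u,\qquad \dot p^i=v^i,\qquad \dot v^i=\frac{A\,(p^i-p_l)}{\|p^i-p_l\|^{2\alpha}}-k\,v^i ,$$ where $\|\cdot\|$ is the Euclidean norm and solutions are required to have $p^i(t)\ne p_l(t)$ throughout. Given an initial state, $R>0$ and $\gamma:[0,1]\to\mathbb R^2$, say that an input $u:[0,T]\to\mathbb R^2$ ($T>0$) *$R$-confines the followers about $\gamma$* if the solution exists on $[0,T]$ and satisfies $$\|\gamma(t/T)-p^i(t)\|<R\quad\text{and}\quad \|\gamma(t/T)-p_l(t)\|\ge R\qquad\text{for all } i\in\{1,\dots,N\},\ t\in[0,T].$$ The system is *$R$-confinement controllable about $\gamma$* if there are $T>0$ and an input $u:[0,T]\to\mathbb R^2$ that $R$-confines the followers about $\gamma$. Then there is $r>0$,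 depending only on $A$, $k$ and $\alpha$, such that for every $N$ and every initial state with $p_l(0)=(1,0)$ and $\|(x^i(0),y^i(0),v^i_x(0),v^i_y(0))\|<r$ for $i=1,\dots,N$, the system is $1$-confinement controllable about every $\gamma=(\gamma_1,\gamma_2)$ with $\gamma_1,\gamma_2\in C^1([0,1])$ and $\gamma(0)=0$. Moreover, for every such initial state and $\gamma$ there are $\omega_1>0$ and $\delta_1>0$ such that for all $\omega>\omega_1$ and all $\delta\in(0,\delta_1)$ the input $$u(t)=\omega\,(-\sin\omega t,\ \cos\omega t)+\delta\,\dot\gamma(\delta t),\qquad t\in[0,T],\quad T=1/\delta,$$ $1$-confines the followers about $\gamma$. -/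

import Mathlib

open Set

/-- The Euclidean plane. -/
abbrev Plane : Type := EuclideanSpace ℝ (Fin 2)

/-- The state of the system with one leader and `N` followers: the position of the leader, and the
positions and velocities of the followers. -/
structure LFState (N : ℕ) where
  leader : Plane
  pos : Fin N → Plane
  vel : Fin N → Plane

/-- The repulsive acceleration `A z / [z₁² + z₂²] ^ α` of a follower whose position relative to the
leader is `z`. -/
noncomputable def repulsion (A α : ℝ) (z : Plane) : Plane :=
  (A / (z 0 ^ 2 + z 1 ^ 2) ^ α) • z

/-- `s` is a solution on `[0, T]`, with initial state `s₀` and leader input `u = (u_x, u_y)`, of the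
leader-follower system with parameters `A`, `k`, `α`. The right-hand side is undefined when a
follower sits at the position of the leader, so a solution has to avoid such collisions. At the end
points of `[0, T]` the derivatives are one-sided. -/
structure IsLFSolution (A k α : ℝ) {N : ℕ} (s₀ : LFState N) (T : ℝ) (u : ℝ → Plane)
    (s : ℝ → LFState N) : Prop where
  initial : s 0 = s₀
  no_collision : ∀ t ∈ Icc 0 T, ∀ i, (s t).pos i ≠ (s t).leader
  leader_deriv : ∀ t ∈ Icc 0 T,
    HasDerivWithinAt (fun τ => (s τ).leader) (u t) (Icc 0 T) t
  pos_deriv : ∀ t ∈ Icc 0 T, ∀ i,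
    HasDerivWithinAt (fun τ => (s τ).pos i) ((s t).vel i) (Icc 0 T) t
  vel_deriv : ∀ t ∈ Icc 0 T, ∀ i,
    HasDerivWithinAt (fun τ => (s τ).vel i)
      (repulsion A α ((s t).pos i - (s t).leader) - k • (s t).vel i) (Icc 0 T) t

/-- The motion `s` keeps, during `[0, T]`, every follower at distance less than `R` from the
time-scaled trajectory `t ↦ γ (t / T)`, and the leader at distance at least `R` from it. -/
def IsConfined {N : ℕ} (R : ℝ) (γ : ℝ → Plane) (T : ℝ) (s : ℝ → LFState N) : Prop :=
  ∀ t ∈ Icc 0 T, (∀ i, ‖γ (t / T) - (s t).pos i‖ < R) ∧ R ≤ ‖γ (t / T) - (s t).leader‖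

/-- Under the leader input `u`, the solution starting at `s₀` exists on all of `[0, T]` and is
confined; the second part speaks about every solution, so nothing hinges on uniqueness. -/
def InputConfines (A k α : ℝ) {N : ℕ} (s₀ : LFState N) (R : ℝ) (γ : ℝ → Plane) (T : ℝ)
    (u : ℝ → Plane) : Prop :=
  (∃ s : ℝ → LFState N, IsLFSolution A k α s₀ T u s) ∧
    ∀ s : ℝ → LFState N, IsLFSolution A k α s₀ T u s → IsConfined R γ T s

/-- `R`-confinement controllability, about the trajectory `γ : [0, 1] → ℝ²`, of the leader-follower
system with initial state `s₀`. Only the values of `γ` on `[0, 1]` and of the input on `[0, T]`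
matter. -/
def IsConfinementControllable (A k α : ℝ) {N : ℕ} (s₀ : LFState N) (R : ℝ) (γ : ℝ → Plane) :
    Prop :=
  ∃ T : ℝ, 0 < T ∧ ∃ u : ℝ → Plane, InputConfines A k α s₀ R γ T u

/-- The leader input `t ↦ ω (- sin ω t, cos ω t) + δ γ' (δ t)`, where `γ'` is the derivative of `γ`
on `[0, 1]`, one-sided at the end points. -/
noncomputable def oscillatoryInput (ω δ : ℝ) (γ : ℝ → Plane) (t : ℝ) : Plane :=
  !₂[-(ω * Real.sin (ω * t)), ω * Real.cos (ω * t)] + δ • derivWithin γ (Icc 0 1) (δ * t)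

open Filter Topology in
/-- A continuous function that starts below the level `L` and has negative derivative whenever it
is at that level stays below it. -/
theorem lt_of_deriv_neg_of_eq {V : ℝ → ℝ} {T L : ℝ} (hc : ContinuousOn V (Icc 0 T)) (h0 : V 0 < L)
    (h : ∀ t ∈ Icc 0 T, V t = L → ∃ V' < 0, HasDerivWithinAt V V' (Icc 0 T) t) :
    ∀ t ∈ Icc 0 T, V t < L := by
  by_contra! hne
  obtain ⟨t₁, ht₁, hV₁⟩ := hne
  have hcomp : IsCompact (Icc 0 T ∩ V ⁻¹' Ici L) :=
    isCompact_Icc.of_isClosed_subset (hc.preimage_isClosed_of_isClosed isClosed_Icc isClosed_Ici)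
      inter_subset_left
  obtain ⟨t₀, ⟨ht₀, hV₀⟩, hmin⟩ := hcomp.exists_isLeast ⟨t₁, ht₁, hV₁⟩
  have hV₀ : L ≤ V t₀ := hV₀
  have hpos : 0 < t₀ := by
    rcases ht₀.1.eq_or_lt with h' | h'
    · rw [← h'] at hV₀; linarith
    · exact h'
  have hlt : ∀ t ∈ Ico 0 t₀, V t < L := by
    intro t ht
    by_contra! h'
    exact absurd (hmin ⟨⟨ht.1, ht.2.le.trans ht₀.2⟩, h'⟩) (not_le.mpr ht.2)
  have hsub : Ico 0 t₀ ⊆ Icc 0 T := fun t ht => ⟨ht.1, ht.2.le.trans ht₀.2⟩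
  have hne : (𝓝[Ico 0 t₀] t₀).NeBot := by
    rw [← mem_closure_iff_nhdsWithin_neBot, closure_Ico hpos.ne]
    exact right_mem_Icc.mpr hpos.le
  have heq : V t₀ = L := by
    refine le_antisymm ?_ hV₀
    refine le_of_tendsto ((hc t₀ ht₀).mono hsub).tendsto ?_
    filter_upwards [self_mem_nhdsWithin] with t ht using (hlt t ht).le
  obtain ⟨V', hV', hd⟩ := h t₀ ht₀ heq
  have hs := (hasDerivWithinAt_iff_tendsto_slope' (by simp)).1 (hd.mono hsub)
  refine absurd (ge_of_tendsto hs ?_) (not_le.mpr hV')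
  filter_upwards [self_mem_nhdsWithin] with t ht
  rw [slope_def_field]
  exact div_nonneg_of_nonpos (by linarith [hlt t ht]) (by linarith [ht.2])

/-- A bounded and Lipschitz vector field has solutions on every compact time interval. -/
theorem exists_hasDerivWithinAt_of_bounded_lipschitz {E : Type*} [NormedAddCommGroup E]
    [NormedSpace ℝ E] [CompleteSpace E] {f : ℝ → E → E} {T : ℝ} (hT : 0 ≤ T) {K L : NNReal}
    (hlip : ∀ t ∈ Icc 0 T, LipschitzWith K (f t))
    (hcont : ∀ x, ContinuousOn (f · x) (Icc 0 T))
    (hbound : ∀ t ∈ Icc 0 T, ∀ x, ‖f t x‖ ≤ L) (x₀ : E) :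
    ∃ x : ℝ → E, x 0 = x₀ ∧ ∀ t ∈ Icc 0 T, HasDerivWithinAt x (f t (x t)) (Icc 0 T) t := by
  have hP : IsPicardLindelof f (tmin := 0) (tmax := T) ⟨0, left_mem_Icc.mpr hT⟩ x₀
      (L * T.toNNReal) 0 L K :=
    { lipschitzOnWith := fun t ht => (hlip t ht).lipschitzOnWith
      continuousOn := fun x _ => hcont x
      norm_le := fun t ht x _ => hbound t ht x
      mul_max_le := by simp [hT] }
  exact hP.exists_eq_forall_mem_Icc_hasDerivWithinAt₀

/-- Second-order Taylor estimate for a negative power at `1`. -/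
theorem exists_abs_one_add_rpow_neg_sub_le {α : ℝ} (hα : 0 < α) :
    ∃ C : ℝ, 0 ≤ C ∧ ∀ s : ℝ, |s| ≤ 1 / 2 → |(1 + s) ^ (-α) - 1 + α * s| ≤ C * s ^ 2 := by
  set B : ℝ := α * (α + 1) * (1 / 2) ^ (-α - 2) with hB
  have hB0 : 0 ≤ B := by positivity
  have hmem : ∀ {s : ℝ}, |s| ≤ 1 / 2 → s ∈ Icc (-(1 / 2) : ℝ) (1 / 2) := fun h => abs_le.mp h
  have hd : ∀ (p : ℝ), ∀ s ∈ Icc (-(1 / 2) : ℝ) (1 / 2),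
      HasDerivAt (fun s : ℝ => (1 + s) ^ p) (p * (1 + s) ^ (p - 1)) s := by
    intro p s hs
    have := ((hasDerivAt_id s).const_add 1).rpow_const (p := p)
      (Or.inl (by simp only [id]; linarith [hs.1]))
    simpa using this
  have h1 : ∀ s ∈ Icc (-(1 / 2) : ℝ) (1 / 2),
      |(-α) * (1 + s) ^ (-α - 1) + α| ≤ B * |s| := by
    intro s hs
    have := (convex_Icc (-(1 / 2) : ℝ) (1 / 2)).norm_image_sub_le_of_norm_hasDerivWithin_le
      (f := fun s : ℝ => (-α) * (1 + s) ^ (-α - 1)) (C := B)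
      (fun x hx => ((hd (-α - 1) x hx).const_mul (-α)).hasDerivWithinAt) (fun x hx => ?_)
      (x := 0) (y := s) (by norm_num) hs
    · simpa using this
    · have hx0 : (0 : ℝ) < 1 + x := by linarith [hx.1]
      have : (1 + x) ^ (-α - 1 - 1) ≤ (1 / 2 : ℝ) ^ (-α - 2) := by
        rw [show -α - 1 - 1 = -α - 2 by ring]
        exact Real.rpow_le_rpow_of_nonpos (by norm_num) (by linarith [hx.1]) (by linarith)
      have h2 : 0 ≤ (1 + x) ^ (-α - 1 - 1) := by positivity
      rw [show -α * ((-α - 1) * (1 + x) ^ (-α - 1 - 1)) = α * (α + 1) * (1 + x) ^ (-α - 1 - 1)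
        by ring, Real.norm_of_nonneg (by positivity), hB]
      gcongr
  refine ⟨B, hB0, fun s hs => ?_⟩
  have hsub : ∀ x ∈ Icc (-|s|) |s|, x ∈ Icc (-(1 / 2) : ℝ) (1 / 2) := fun x hx =>
    ⟨by linarith [hx.1], by linarith [hx.2]⟩
  have := (convex_Icc (-|s|) |s|).norm_image_sub_le_of_norm_hasDerivWithin_le
      (f := fun s : ℝ => (1 + s) ^ (-α) + α * s) (C := B * |s|)
      (fun x hx => ((hd (-α) x (hsub x hx)).add
        ((hasDerivAt_id x).const_mul α)).hasDerivWithinAt) (fun x hx => ?_)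
      (x := 0) (y := s) (by simp) ⟨neg_abs_le s, le_abs_self s⟩
  · simp only [Real.norm_eq_abs, add_zero, Real.one_rpow, mul_zero, sub_zero] at this
    rw [mul_assoc, ← sq, sq_abs] at this
    rwa [sub_add_eq_add_sub]
  · rw [mul_one, Real.norm_eq_abs]
    exact (h1 x (hsub x hx)).trans (mul_le_mul_of_nonneg_left (abs_le.mpr hx) hB0)

/-- Negative powers are Lipschitz away from `0`. -/
theorem exists_abs_rpow_neg_sub_rpow_neg_le {α : ℝ} (hα : 0 < α) :
    ∃ C : ℝ, 0 ≤ C ∧ ∀ x y : ℝ, 1 / 4 ≤ x → 1 / 4 ≤ y → |x ^ (-α) - y ^ (-α)| ≤ C * |x - y| := by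
  refine ⟨α * (1 / 4) ^ (-α - 1), by positivity, fun x y hx hy => ?_⟩
  refine (convex_Ici (1 / 4 : ℝ)).norm_image_sub_le_of_norm_hasDerivWithin_le
      (f := fun s : ℝ => s ^ (-α))
      (fun s hs => (Real.hasDerivAt_rpow_const (Or.inl ?_)).hasDerivWithinAt)
      (fun s hs => ?_) hy hx
  · exact (lt_of_lt_of_le (by norm_num) (mem_Ici.mp hs)).ne'
  · have hs' : (1 / 4 : ℝ) ≤ s := hs
    have : 0 ≤ s ^ (-α - 1) := Real.rpow_nonneg (by linarith) _
    rw [neg_mul, norm_neg, Real.norm_of_nonneg (by positivity)]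
    have := Real.rpow_le_rpow_of_nonpos (by norm_num) hs' (show -α - 1 ≤ 0 by linarith)
    gcongr

theorem repulsion_eq (A α : ℝ) (z : Plane) :
    repulsion A α z = (A * (‖z‖ ^ 2) ^ (-α)) • z := by
  rw [repulsion, EuclideanSpace.real_norm_sq_eq, Fin.sum_univ_two, Real.rpow_neg (by positivity),
    div_eq_mul_inv]

/-- First-order expansion of the repulsion at a unit vector. -/
theorem exists_norm_repulsion_sub_le {A α : ℝ} (hA : 0 < A) (hα : 0 < α) :
    ∃ C : ℝ, 0 ≤ C ∧ ∀ e q : Plane, ‖e‖ = 1 → ‖q‖ ≤ 1 / 8 →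
      ‖repulsion A α (q - e) - A • (q - e - (2 * α * inner ℝ e q) • e)‖ ≤ C * ‖q‖ ^ 2 := by
  obtain ⟨C, hC, h⟩ := exists_abs_one_add_rpow_neg_sub_le hα
  refine ⟨A * (9 * C + 3 * α + α + 9 * C), by positivity, fun e q he hq => ?_⟩
  set s : ℝ := ‖q‖ ^ 2 - 2 * inner ℝ e q with hs
  set a := ‖q‖ with ha
  have ha0 : 0 ≤ a := norm_nonneg q
  have hin : |inner ℝ e q| ≤ a := by simpa [he] using abs_real_inner_le_norm e q
  have hsabs : |s| ≤ 3 * a := by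
    rw [abs_le] at hin ⊢
    constructor <;> nlinarith
  have hnorm : ‖q - e‖ ^ 2 = 1 + s := by
    rw [norm_sub_sq_real, he, real_inner_comm, hs]; ring
  have hg := h s (hsabs.trans (by linarith))
  have hs2 : s ^ 2 ≤ 9 * a ^ 2 := by
    rw [← sq_abs]; nlinarith [abs_nonneg s]
  set g := (1 + s) ^ (-α) - 1 + α * s with hgdef
  have hg' : |g| ≤ 9 * C * a ^ 2 := hg.trans (by nlinarith)
  have key : repulsion A α (q - e) - A • (q - e - (2 * α * inner ℝ e q) • e) =
      A • ((g - α * s) • q - g • e + (α * a ^ 2) • e) := by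
    rw [repulsion_eq, hnorm, show (1 + s) ^ (-α) = g + 1 - α * s by rw [hgdef]; ring]
    rw [show inner ℝ e q = (a ^ 2 - s) / 2 by rw [hs]; ring]
    module
  rw [key, norm_smul, Real.norm_of_nonneg hA.le, mul_assoc]
  gcongr
  have e1 : ‖(g - α * s) • q‖ ≤ (9 * C + 3 * α) * a ^ 2 := by
    rw [norm_smul, Real.norm_eq_abs, ← ha]
    have : |g - α * s| ≤ 9 * C * a ^ 2 + α * (3 * a) := by
      refine (abs_sub _ _).trans ?_
      rw [abs_mul, abs_of_pos hα]
      gcongr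
    calc _ ≤ (9 * C * a ^ 2 + α * (3 * a)) * a := by gcongr
      _ = 9 * C * a ^ 2 * a + 3 * α * a ^ 2 := by ring
      _ ≤ 9 * C * a ^ 2 * 1 + 3 * α * a ^ 2 := by gcongr; linarith
      _ = _ := by ring
  have e2 : ‖g • e‖ ≤ 9 * C * a ^ 2 := by rwa [norm_smul, he, mul_one, Real.norm_eq_abs]
  have e3 : ‖(α * a ^ 2) • e‖ ≤ α * a ^ 2 := by
    rw [norm_smul, he, mul_one, Real.norm_of_nonneg (by positivity)]
  linarith [norm_add_le ((g - α * s) • q - g • e) ((α * a ^ 2) • e),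
    norm_sub_le ((g - α * s) • q) (g • e)]

/-- The repulsion is bounded and Lipschitz on an annulus around the origin. -/
theorem exists_repulsion_bounded_lipschitz {A α : ℝ} (hA : 0 < A) (hα : 0 < α) :
    ∃ C : ℝ, 0 ≤ C ∧
      (∀ z : Plane, 1 / 2 ≤ ‖z‖ → ‖z‖ ≤ 2 → ‖repulsion A α z‖ ≤ C) ∧
      ∀ z z' : Plane, 1 / 2 ≤ ‖z‖ → ‖z‖ ≤ 2 → 1 / 2 ≤ ‖z'‖ → ‖z'‖ ≤ 2 →
        ‖repulsion A α z - repulsion A α z'‖ ≤ C * ‖z - z'‖ := by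
  obtain ⟨D, hD, hlip⟩ := exists_abs_rpow_neg_sub_rpow_neg_le hα
  set B : ℝ := (1 / 4) ^ (-α) with hB
  have hB0 : 0 ≤ B := by positivity
  have hpow : ∀ z : Plane, 1 / 2 ≤ ‖z‖ → |(‖z‖ ^ 2) ^ (-α)| ≤ B := by
    intro z hz
    rw [abs_of_nonneg (by positivity)]
    exact Real.rpow_le_rpow_of_nonpos (by norm_num) (by nlinarith) (by linarith)
  refine ⟨A * (2 * B + 8 * D), by positivity, fun z h1 h2 => ?_, fun z z' h1 h2 h3 h4 => ?_⟩
  · rw [repulsion_eq, norm_smul, norm_mul, Real.norm_of_nonneg hA.le, Real.norm_eq_abs, mul_assoc]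
    have : |(‖z‖ ^ 2) ^ (-α)| * ‖z‖ ≤ B * 2 := by gcongr; exact hpow z h1
    gcongr
    linarith
  · have key : repulsion A α z - repulsion A α z' =
        A • ((‖z‖ ^ 2) ^ (-α) • (z - z') + ((‖z‖ ^ 2) ^ (-α) - (‖z'‖ ^ 2) ^ (-α)) • z') := by
      rw [repulsion_eq, repulsion_eq]; module
    rw [key, norm_smul, Real.norm_of_nonneg hA.le, mul_assoc]
    gcongr
    have e1 : ‖(‖z‖ ^ 2) ^ (-α) • (z - z')‖ ≤ B * ‖z - z'‖ := by
      rw [norm_smul, Real.norm_eq_abs]; gcongr; exact hpow z h1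
    have e0 : |‖z‖ ^ 2 - ‖z'‖ ^ 2| ≤ 4 * ‖z - z'‖ := by
      rw [sq_sub_sq, abs_mul, abs_of_nonneg (by positivity)]
      gcongr
      · linarith
      · exact abs_norm_sub_norm_le z z'
    have e2 : ‖((‖z‖ ^ 2) ^ (-α) - (‖z'‖ ^ 2) ^ (-α)) • z'‖ ≤ D * (4 * ‖z - z'‖) * 2 := by
      rw [norm_smul, Real.norm_eq_abs]
      gcongr
      exact (hlip _ _ (by nlinarith) (by nlinarith)).trans (by gcongr)
    refine (norm_add_le _ _).trans ?_
    have : 0 ≤ B * ‖z - z'‖ := by positivity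
    linarith

/-- Lyapunov function of the damped oscillator `q'' = - c q - k q'`. -/
noncomputable def oscillatorEnergy (c k : ℝ) (q w : Plane) : ℝ :=
  c / 2 * ‖q‖ ^ 2 + 1 / 4 * ‖w‖ ^ 2 + 1 / 4 * ‖w + k • q‖ ^ 2

/-- Derivative of `oscillatorEnergy` along `q' = w + E₁`, `w' = - c q - k w + E₂`. -/
noncomputable def oscillatorEnergyDeriv (c k : ℝ) (q w q' w' : Plane) : ℝ :=
  c * inner ℝ q q' + 1 / 2 * inner ℝ w w' + 1 / 2 * inner ℝ (w + k • q) (w' + k • q')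

theorem hasDerivWithinAt_oscillatorEnergy (c k : ℝ) {q w : ℝ → Plane} {q' w' : Plane} {s : Set ℝ}
    {t : ℝ} (hq : HasDerivWithinAt q q' s t) (hw : HasDerivWithinAt w w' s t) :
    HasDerivWithinAt (fun t => oscillatorEnergy c k (q t) (w t))
      (oscillatorEnergyDeriv c k (q t) (w t) q' w') s t := by
  have := ((hq.norm_sq.const_mul (c / 2)).add (hw.norm_sq.const_mul (1 / 4))).add
    ((hw.add (hq.const_smul k)).norm_sq.const_mul (1 / 4))
  refine this.congr_deriv ?_
  rw [oscillatorEnergyDeriv]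
  simp only [Pi.add_apply, Pi.smul_apply]
  ring

theorem oscillatorEnergyDeriv_eq (c k : ℝ) (q w E₁ E₂ : Plane) :
    oscillatorEnergyDeriv c k q w (w + E₁) (-(c • q) - k • w + E₂) =
      -(k / 2) * (‖w‖ ^ 2 + c * ‖q‖ ^ 2) +
      (c * inner ℝ q E₁ + 1 / 2 * inner ℝ w E₂ + 1 / 2 * inner ℝ (w + k • q) (E₂ + k • E₁)) := by
  rw [oscillatorEnergyDeriv]
  simp only [inner_add_left, inner_add_right, inner_sub_right, inner_neg_right, inner_smul_left,
    inner_smul_right, real_inner_self_eq_norm_sq, real_inner_comm w q, RCLike.conj_to_real,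
    smul_add]
  ring

set_option maxHeartbeats 1000000 in
theorem exists_oscillatorEnergy_level {c k C : ℝ} (hc : 0 < c) (hk : 0 < k) (hC : 0 ≤ C) :
    ∃ L > 0, ∃ η > 0, ∃ r > 0,
      (∀ q w, oscillatorEnergy c k q w ≤ L → ‖q‖ ≤ 1 / 8 ∧ ‖w‖ ≤ 1) ∧
      (∀ q w, ‖q‖ ≤ r → ‖w‖ ≤ 2 * r → oscillatorEnergy c k q w < L) ∧
      ∀ q w E₁ E₂, oscillatorEnergy c k q w = L → ‖E₁‖ ≤ η → ‖E₂‖ ≤ C * ‖q‖ ^ 2 + η →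
        oscillatorEnergyDeriv c k q w (w + E₁) (-(c • q) - k • w + E₂) < 0 := by
  set K : ℝ := 1 + k ^ 2 / c with hK
  set m : ℝ := 1 + 2 / c with hm
  have hcm : 2 ≤ c * m ^ 2 := by
    have : c * m ^ 2 = c + 4 + 4 / c := by rw [hm]; field_simp; ring
    rw [this]; have : 0 < 4 / c := by positivity
    linarith
  have hK0 : 0 < K := by positivity
  have hm1 : 0 < m := by positivity
  set D₂ : ℝ := (1 + 1 / 2 * (2 + k * m)) * (C * m ^ 2) with hD₂
  set D₁ : ℝ := c * m + 1 + 1 / 2 * (2 + k * m) * (1 + k) with hD₁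
  have hD₂0 : 0 ≤ D₂ := by positivity
  have hD₁0 : 0 < D₁ := by positivity
  obtain ⟨l, hl0, hl1, hl2, hl3⟩ : ∃ l : ℝ, 0 < l ∧ l ≤ 1 / 2 ∧ m * l ≤ 1 / 8 ∧
      D₂ * l ≤ k / (8 * K) := by
    refine ⟨min (1 / 2) (min (1 / (8 * m)) (k / (8 * K) / (D₂ + 1))), by positivity,
      min_le_left _ _, ?_, ?_⟩
    · calc _ ≤ m * (1 / (8 * m)) := by
            gcongr; exact (min_le_right _ _).trans (min_le_left _ _)
        _ = 1 / 8 := by field_simp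
    · calc _ ≤ (D₂ + 1) * (k / (8 * K) / (D₂ + 1)) := by
            gcongr
            · linarith
            · exact (min_le_right _ _).trans (min_le_right _ _)
        _ = k / (8 * K) := by field_simp
  have hbd : ∀ q w, oscillatorEnergy c k q w ≤ l ^ 2 → ‖q‖ ≤ m * l ∧ ‖w‖ ≤ 2 * l := by
    intro q w h
    rw [oscillatorEnergy] at h
    have h1 : 0 ≤ ‖w + k • q‖ ^ 2 := by positivity
    have h2 : 0 ≤ ‖w‖ ^ 2 := by positivity
    have h3 : 0 ≤ c * ‖q‖ ^ 2 := by positivity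
    constructor
    · refine abs_le_of_sq_le_sq' ?_ (by positivity) |>.2
      have : c * ‖q‖ ^ 2 ≤ c * (m * l) ^ 2 := by nlinarith [sq_nonneg l]
      exact le_of_mul_le_mul_left this hc
    · refine abs_le_of_sq_le_sq' ?_ (by positivity) |>.2
      nlinarith
  have hsum : ∀ q w : Plane, ‖w + k • q‖ ≤ ‖w‖ + k * ‖q‖ := fun q w =>
    (norm_add_le _ _).trans (by rw [norm_smul, Real.norm_of_nonneg hk.le])
  refine ⟨l ^ 2, by positivity, k * l / (8 * K * D₁), by positivity,
    l / (c + 2 + (2 + k)), by positivity, fun q w h => ?_, fun q w hq hw => ?_,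
    fun q w E₁ E₂ h h₁ h₂ => ?_⟩
  · obtain ⟨h1, h2⟩ := hbd q w h
    exact ⟨h1.trans hl2, h2.trans (by linarith)⟩
  · set r := l / (c + 2 + (2 + k)) with hr
    have hr0 : 0 < r := by positivity
    have hs : ‖w + k • q‖ ≤ (2 + k) * r := (hsum q w).trans (by nlinarith)
    have hlr : l = (c + 2 + (2 + k)) * r := by rw [hr]; field_simp
    have a1 : ‖q‖ ^ 2 ≤ r ^ 2 := by gcongr
    have a2 : ‖w‖ ^ 2 ≤ (2 * r) ^ 2 := by gcongr
    have a3 : ‖w + k • q‖ ^ 2 ≤ ((2 + k) * r) ^ 2 := by gcongr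
    rw [oscillatorEnergy, hlr]
    calc _ ≤ c / 2 * r ^ 2 + 1 / 4 * (2 * r) ^ 2 + 1 / 4 * ((2 + k) * r) ^ 2 := by gcongr
      _ = (c / 2 + 1 + 1 / 4 * (2 + k) ^ 2) * r ^ 2 := by ring
      _ < (c + 2 + (2 + k)) ^ 2 * r ^ 2 := by gcongr; nlinarith [mul_pos hc hk]
      _ = _ := by ring
  · obtain ⟨hq, hw⟩ := hbd q w h.le
    set η := k * l / (8 * K * D₁) with hη
    have hη0 : 0 < η := by positivity
    have hs : ‖w + k • q‖ ≤ (2 + k * m) * l := (hsum q w).trans (by nlinarith)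
    have hE₂ : ‖E₂‖ ≤ C * m ^ 2 * l ^ 2 + η := by
      refine h₂.trans ?_
      calc C * ‖q‖ ^ 2 + η ≤ C * (m * l) ^ 2 + η := by gcongr
        _ = _ := by ring
    have hE₃ : ‖E₂ + k • E₁‖ ≤ C * m ^ 2 * l ^ 2 + η + k * η :=
      (norm_add_le _ _).trans (by
        rw [norm_smul, Real.norm_of_nonneg hk.le]; gcongr)
    have i1 : inner ℝ q E₁ ≤ m * l * η := (real_inner_le_norm _ _).trans (by gcongr)
    have i2 : inner ℝ w E₂ ≤ 2 * l * (C * m ^ 2 * l ^ 2 + η) :=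
      (real_inner_le_norm _ _).trans (by gcongr)
    have i3 : inner ℝ (w + k • q) (E₂ + k • E₁) ≤
        (2 + k * m) * l * (C * m ^ 2 * l ^ 2 + η + k * η) :=
      (real_inner_le_norm _ _).trans (by gcongr)
    have herr : c * inner ℝ q E₁ + 1 / 2 * inner ℝ w E₂ +
        1 / 2 * inner ℝ (w + k • q) (E₂ + k • E₁) ≤ l * (D₁ * η + D₂ * l * l) := by
      calc _ ≤ c * (m * l * η) + 1 / 2 * (2 * l * (C * m ^ 2 * l ^ 2 + η)) +
            1 / 2 * ((2 + k * m) * l * (C * m ^ 2 * l ^ 2 + η + k * η)) := by gcongr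
        _ = _ := by rw [hD₁, hD₂]; ring
    have hlow : l ^ 2 / K ≤ ‖w‖ ^ 2 + c * ‖q‖ ^ 2 := by
      rw [div_le_iff₀ hK0, ← h, oscillatorEnergy]
      have : ‖w + k • q‖ ^ 2 ≤ 2 * ‖w‖ ^ 2 + 2 * k ^ 2 * ‖q‖ ^ 2 := by
        calc _ ≤ (‖w‖ + k * ‖q‖) ^ 2 := by gcongr; exact hsum q w
          _ ≤ _ := by nlinarith [sq_nonneg (‖w‖ - k * ‖q‖)]
      have e : (‖w‖ ^ 2 + c * ‖q‖ ^ 2) * K =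
          ‖w‖ ^ 2 + c * ‖q‖ ^ 2 + k ^ 2 / c * ‖w‖ ^ 2 + k ^ 2 * ‖q‖ ^ 2 := by
        rw [hK]; field_simp; ring
      have p1 : 0 ≤ k ^ 2 / c * ‖w‖ ^ 2 := by positivity
      have p2 : 0 ≤ k ^ 2 * ‖q‖ ^ 2 := by positivity
      have p3 : 0 ≤ c * ‖q‖ ^ 2 := by positivity
      have p4 : 0 ≤ ‖w‖ ^ 2 := by positivity
      linarith
    rw [oscillatorEnergyDeriv_eq]
    have hDη : D₁ * η = k / (8 * K) * l := by rw [hη]; field_simp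
    have f1 : l * (D₁ * η + D₂ * l * l) ≤ k / (4 * K) * l ^ 2 := by
      calc _ ≤ l * (k / (8 * K) * l + k / (8 * K) * l) := by rw [hDη]; gcongr
        _ = _ := by field_simp; ring
    have f2 : k / 2 * (l ^ 2 / K) ≤ k / 2 * (‖w‖ ^ 2 + c * ‖q‖ ^ 2) := by gcongr
    have f3 : k / 2 * (l ^ 2 / K) = 2 * (k / (4 * K) * l ^ 2) := by field_simp; ring
    have f4 : 0 < k / (4 * K) * l ^ 2 := by positivity
    linarith

/-- The point of the unit circle at angle `θ`. -/
noncomputable def circleDir (θ : ℝ) : Plane := !₂[Real.cos θ, Real.sin θ]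

/-- The unit tangent of the circle at angle `θ`. -/
noncomputable def circleTangent (θ : ℝ) : Plane := !₂[-Real.sin θ, Real.cos θ]

theorem norm_circleDir (θ : ℝ) : ‖circleDir θ‖ = 1 := by
  simp [circleDir, EuclideanSpace.norm_eq, Fin.sum_univ_two]

theorem norm_circleTangent (θ : ℝ) : ‖circleTangent θ‖ = 1 := by
  simp [circleTangent, EuclideanSpace.norm_eq, Fin.sum_univ_two]

theorem inner_smul_circleDir_add (θ : ℝ) (q : Plane) :
    inner ℝ (circleDir θ) q • circleDir θ + inner ℝ (circleTangent θ) q • circleTangent θ = q := by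
  have h := Real.sin_sq_add_cos_sq θ
  ext i
  fin_cases i
  · simp [circleDir, circleTangent, PiLp.inner_apply, Fin.sum_univ_two]
    linear_combination (q 0) * h
  · simp [circleDir, circleTangent, PiLp.inner_apply, Fin.sum_univ_two]
    linear_combination (q 1) * h

theorem hasDerivAt_circleDir (ω t : ℝ) :
    HasDerivAt (fun t => circleDir (ω * t)) (ω • circleTangent (ω * t)) t := by
  have hθ : HasDerivAt (fun t => ω * t) ω t := by simpa using (hasDerivAt_id t).const_mul ω
  have := (hθ.cos.smul_const (!₂[1, 0] : Plane)).add (hθ.sin.smul_const (!₂[0, 1] : Plane))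
  have hfun : (fun t => circleDir (ω * t)) = fun t =>
      Real.cos (ω * t) • (!₂[1, 0] : Plane) + Real.sin (ω * t) • (!₂[0, 1] : Plane) := by
    funext t; ext i; fin_cases i <;> simp [circleDir]
  rw [hfun]
  refine this.congr_deriv ?_
  ext i; fin_cases i <;> simp [circleTangent, mul_comm]

theorem hasDerivAt_circleTangent (ω t : ℝ) :
    HasDerivAt (fun t => circleTangent (ω * t)) (-(ω • circleDir (ω * t))) t := by
  have hθ : HasDerivAt (fun t => ω * t) ω t := by simpa using (hasDerivAt_id t).const_mul ω
  have := (hθ.sin.smul_const (!₂[-1, 0] : Plane)).add (hθ.cos.smul_const (!₂[0, 1] : Plane))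
  have hfun : (fun t => circleTangent (ω * t)) = fun t =>
      Real.sin (ω * t) • (!₂[-1, 0] : Plane) + Real.cos (ω * t) • (!₂[0, 1] : Plane) := by
    funext t; ext i; fin_cases i <;> simp [circleTangent]
  rw [hfun]
  refine this.congr_deriv ?_
  ext i; fin_cases i <;> simp [circleDir, mul_comm]

/-- The linear map whose derivative in `θ` is `2 (1 - 2 e ⊗ e)`, with `e = circleDir θ`. -/
noncomputable def circleMix (θ : ℝ) (q : Plane) : Plane :=
  inner ℝ (circleTangent θ) q • circleDir θ + inner ℝ (circleDir θ) q • circleTangent θ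

theorem norm_circleMix_le (θ : ℝ) (q : Plane) : ‖circleMix θ q‖ ≤ 2 * ‖q‖ := by
  have h1 := norm_inner_le_norm (𝕜 := ℝ) (circleTangent θ) q
  have h2 := norm_inner_le_norm (𝕜 := ℝ) (circleDir θ) q
  refine (norm_add_le _ _).trans ?_
  rw [norm_smul, norm_smul, norm_circleDir, norm_circleTangent]
  rw [norm_circleDir] at h2
  rw [norm_circleTangent] at h1
  linarith

theorem hasDerivWithinAt_circleMix (ω : ℝ) {q : ℝ → Plane} {q' : Plane} {s : Set ℝ} {t : ℝ}
    (hq : HasDerivWithinAt q q' s t) :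
    HasDerivWithinAt (fun t => circleMix (ω * t) (q t))
      ((2 * ω) • (q t - (2 * inner ℝ (circleDir (ω * t)) (q t)) • circleDir (ω * t)) +
        circleMix (ω * t) q') s t := by
  have he := (hasDerivAt_circleDir ω t).hasDerivWithinAt (s := s)
  have hn := (hasDerivAt_circleTangent ω t).hasDerivWithinAt (s := s)
  have := ((hn.inner ℝ hq).smul he).add ((he.inner ℝ hq).smul hn)
  refine this.congr_deriv ?_
  have key := inner_smul_circleDir_add (ω * t) (q t)
  simp only [inner_neg_left, inner_smul_left, RCLike.conj_to_real, circleMix]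
  set a := inner ℝ (circleDir (ω * t)) (q t)
  set b := inner ℝ (circleTangent (ω * t)) (q t)
  rw [← key]
  module

/-- The oscillating correction that turns the velocity into a slow variable. -/
noncomputable def velocityCorrection (A α ω t : ℝ) (q : Plane) : Plane :=
  (A / ω) • circleTangent (ω * t) + (A * α / (2 * ω)) • circleMix (ω * t) q

theorem norm_velocityCorrection_le {A α ω : ℝ} (hA : 0 < A) (hα : 0 < α) (hω : 0 < ω) (t : ℝ)
    {q : Plane} (hq : ‖q‖ ≤ 1) : ‖velocityCorrection A α ω t q‖ ≤ (A + A * α) / ω := by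
  have h := (norm_circleMix_le (ω * t) q).trans (mul_le_mul_of_nonneg_left hq zero_le_two)
  refine (norm_add_le _ _).trans ?_
  rw [norm_smul, norm_smul, norm_circleTangent, Real.norm_of_nonneg (by positivity),
    Real.norm_of_nonneg (by positivity)]
  calc _ ≤ A / ω * 1 + A * α / (2 * ω) * (2 * 1) := by gcongr
    _ = _ := by field_simp

theorem hasDerivWithinAt_velocityCorrection (A α : ℝ) {ω : ℝ} (hω : 0 < ω) {q : ℝ → Plane}
    {q' : Plane} {s : Set ℝ} {t : ℝ} (hq : HasDerivWithinAt q q' s t) :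
    HasDerivWithinAt (fun t => velocityCorrection A α ω t (q t))
      (-(A • circleDir (ω * t)) +
        (A * α) • (q t - (2 * inner ℝ (circleDir (ω * t)) (q t)) • circleDir (ω * t)) +
        (A * α / (2 * ω)) • circleMix (ω * t) q') s t := by
  have := ((hasDerivAt_circleTangent ω t).hasDerivWithinAt (s := s).const_smul (A / ω)).add
    ((hasDerivWithinAt_circleMix ω hq).const_smul (A * α / (2 * ω)))
  refine this.congr_deriv ?_
  rw [smul_add, smul_smul, smul_neg, smul_smul, div_mul_cancel₀ _ hω.ne',
    div_mul_cancel₀ _ (by positivity), add_assoc]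

theorem continuous_circleDir : Continuous circleDir := by
  have : Continuous fun t => circleDir (1 * t) :=
    continuous_iff_continuousAt.mpr fun t => (hasDerivAt_circleDir 1 t).continuousAt
  simpa using this

theorem continuous_circleTangent : Continuous circleTangent := by
  have : Continuous fun t => circleTangent (1 * t) :=
    continuous_iff_continuousAt.mpr fun t => (hasDerivAt_circleTangent 1 t).continuousAt
  simpa using this

theorem continuousOn_velocityCorrection (A α ω : ℝ) {q : ℝ → Plane} {s : Set ℝ}
    (hq : ContinuousOn q s) : ContinuousOn (fun t => velocityCorrection A α ω t (q t)) s := by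
  have he : ContinuousOn (fun t => circleDir (ω * t)) s :=
    (continuous_circleDir.comp (continuous_const_mul ω)).continuousOn
  have hn : ContinuousOn (fun t => circleTangent (ω * t)) s :=
    (continuous_circleTangent.comp (continuous_const_mul ω)).continuousOn
  have h1 : ContinuousOn (fun t => inner ℝ (circleTangent (ω * t)) (q t)) s :=
    ContinuousOn.inner (𝕜 := ℝ) hn hq
  have h2 : ContinuousOn (fun t => inner ℝ (circleDir (ω * t)) (q t)) s :=
    ContinuousOn.inner (𝕜 := ℝ) he hq
  have h3 : ContinuousOn (fun t => circleMix (ω * t) (q t)) s :=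
    (h1.smul he).add (h2.smul hn)
  exact (hn.const_smul (A / ω)).add (h3.const_smul (A * α / (2 * ω)))

/-- A pair position-velocity, relative to the centre of the moving circle, that starts near the
origin and satisfies the equations of motion while it is near the origin stays there, if the
frequency is high and the drift `d` is slow. -/
theorem exists_forall_norm_le_of_hasDerivWithinAt {A k α : ℝ} (hA : 0 < A) (hk : 0 < k)
    (hα : 1 < α) :
    ∃ r > 0, ∀ M : ℝ, 0 ≤ M → ∃ ω₁ > 0, ∃ δ₁ > 0, ∀ ω δ : ℝ, ω₁ < ω → 0 < δ → δ < δ₁ →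
      ∀ (T : ℝ) (d q v : ℝ → Plane), 0 ≤ T → (∀ t ∈ Icc 0 T, ‖d t‖ ≤ δ * M) →
        ‖q 0‖ < r → ‖v 0‖ < r → ContinuousOn q (Icc 0 T) → ContinuousOn v (Icc 0 T) →
        (∀ t ∈ Icc 0 T, ‖q t‖ ≤ 1 / 8 → ‖v t‖ ≤ 2 →
          HasDerivWithinAt q (v t - d t) (Icc 0 T) t ∧
          HasDerivWithinAt v (repulsion A α (q t - circleDir (ω * t)) - k • v t) (Icc 0 T) t) →
        ∀ t ∈ Icc 0 T, ‖q t‖ ≤ 1 / 8 ∧ ‖v t‖ ≤ 2 := by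
  have hα0 : 0 < α := by linarith
  obtain ⟨C, hC, hexp⟩ := exists_norm_repulsion_sub_le hA hα0
  have hc : 0 < A * (α - 1) := mul_pos hA (by linarith)
  set c := A * (α - 1) with hcdef
  obtain ⟨L, hL, η, hη, r, hr, hsmall, hinit, hneg⟩ := exists_oscillatorEnergy_level hc hk hC
  refine ⟨r, hr, fun M hM => ?_⟩
  obtain ⟨ε, hε, hε1, hεr, hεη⟩ : ∃ ε : ℝ, 0 < ε ∧ ε ≤ 1 ∧ ε ≤ r ∧ (2 + k + η) * ε ≤ η := by
    refine ⟨min 1 (min r (η / (2 + k + η))), by positivity, min_le_left _ _,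
      (min_le_right _ _).trans (min_le_left _ _), ?_⟩
    calc _ ≤ (2 + k + η) * (η / (2 + k + η)) := by
          gcongr; exact (min_le_right _ _).trans (min_le_right _ _)
      _ = η := by field_simp
  refine ⟨(A + A * α) / ε, by positivity, η / (2 * (M + 1)), by positivity, ?_⟩
  intro ω δ hω hδ hδ₁ T d q v hT hd hq0 hv0 hqc hvc hode
  have hω0 : 0 < ω := lt_trans (by positivity) hω
  have hωε : (A + A * α) / ω ≤ ε := by
    rw [div_lt_iff₀ hε] at hω
    rw [div_le_iff₀ hω0]; linarith
  have hδM : δ * M ≤ η / 2 := by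
    rw [lt_div_iff₀ (by positivity)] at hδ₁
    nlinarith
  have hcorr : ∀ t (q : Plane), ‖q‖ ≤ 1 / 8 → ‖velocityCorrection A α ω t q‖ ≤ ε := fun t q h =>
    (norm_velocityCorrection_le hA hα0 hω0 t (h.trans (by norm_num))).trans hωε
  set w : ℝ → Plane := fun t => v t - velocityCorrection A α ω t (q t) with hw
  have hvw : ∀ t, ‖q t‖ ≤ 1 / 8 → ‖w t‖ ≤ 1 → ‖v t‖ ≤ 2 := by
    intro t h1 h2
    have : v t = w t + velocityCorrection A α ω t (q t) := by simp [hw]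
    rw [this]
    exact (norm_add_le _ _).trans (by linarith [hcorr t _ h1])
  have hwc : ContinuousOn w (Icc 0 T) := hvc.sub (continuousOn_velocityCorrection A α ω hqc)
  have hVc : ContinuousOn (fun t => oscillatorEnergy c k (q t) (w t)) (Icc 0 T) := by
    unfold oscillatorEnergy
    exact (((hqc.norm.pow 2).const_mul _).add ((hwc.norm.pow 2).const_mul _)).add
      (((hwc.add (hqc.const_smul k)).norm.pow 2).const_mul _)
  have hq8 : ‖q 0‖ ≤ 1 / 8 :=
    (hsmall (q 0) 0 (hinit _ _ hq0.le (by rw [norm_zero]; positivity)).le).1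
  have hV0 : oscillatorEnergy c k (q 0) (w 0) < L := by
    refine hinit _ _ hq0.le ((norm_sub_le _ _).trans ?_)
    linarith [hcorr 0 _ hq8]
  have hV := lt_of_deriv_neg_of_eq hVc hV0 (fun t ht hVt => ?_)
  · intro t ht
    obtain ⟨h1, h2⟩ := hsmall _ _ (hV t ht).le
    exact ⟨h1, hvw t h1 h2⟩
  obtain ⟨h1, h2⟩ := hsmall _ _ hVt.le
  obtain ⟨hq', hv'⟩ := hode t ht h1 (hvw t h1 h2)
  have hw' := hv'.sub (hasDerivWithinAt_velocityCorrection A α hω0 hq')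
  set e := circleDir (ω * t) with he
  set κ := velocityCorrection A α ω t (q t) with hκ
  set R := repulsion A α (q t - e) - A • (q t - e - (2 * α * inner ℝ e (q t)) • e) with hR
  set μ := (A * α / (2 * ω)) • circleMix (ω * t) (v t - d t) with hμ
  have hRle : ‖R‖ ≤ C * ‖q t‖ ^ 2 := hexp e (q t) (norm_circleDir _) h1
  have hE₁ : ‖κ - d t‖ ≤ ε + η / 2 :=
    (norm_sub_le _ _).trans (add_le_add (hcorr t _ h1) ((hd t ht).trans hδM))
  have hεη' : ε ≤ η / 2 := by nlinarith
  have hqd : v t - d t = w t + (κ - d t) := by simp only [hw]; abel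
  have hμle : ‖μ‖ ≤ ε * (1 + η) := by
    have h3 : ‖v t - d t‖ ≤ 1 + η := by
      rw [hqd]
      exact (norm_add_le _ _).trans (by linarith)
    rw [hμ, norm_smul, Real.norm_of_nonneg (by positivity)]
    calc _ ≤ A * α / (2 * ω) * (2 * (1 + η)) := by
          gcongr; exact (norm_circleMix_le _ _).trans (by gcongr)
      _ = A * α / ω * (1 + η) := by field_simp
      _ ≤ ε * (1 + η) := by
          gcongr
          refine le_trans ?_ hωε
          gcongr
          linarith
  have hE₂ : ‖R - k • κ - μ‖ ≤ C * ‖q t‖ ^ 2 + η := by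
    have h3 : ‖k • κ‖ ≤ k * ε := by
      rw [norm_smul, Real.norm_of_nonneg hk.le]; gcongr; exact hcorr t _ h1
    linarith [norm_sub_le (R - k • κ) μ, norm_sub_le R (k • κ)]
  refine ⟨_, hneg (q t) (w t) (κ - d t) (R - k • κ - μ) hVt (by linarith) hE₂,
    hasDerivWithinAt_oscillatorEnergy c k (hq'.congr_deriv hqd) (hw'.congr_deriv ?_)⟩
  simp only [hw, hR, hcdef]
  rw [← hκ]
  module

/-- Coordinatewise truncation of a vector to `[-a, a]`. -/
noncomputable def planeClamp (a : ℝ) (z : Plane) : Plane :=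
  !₂[max (-a) (min a (z 0)), max (-a) (min a (z 1))]

theorem norm_planeClamp_sub_le (a : ℝ) (z z' : Plane) :
    ‖planeClamp a z - planeClamp a z'‖ ≤ ‖z - z'‖ := by
  have h : ∀ x y : ℝ, (max (-a) (min a x) - max (-a) (min a y)) ^ 2 ≤ (x - y) ^ 2 := by
    intro x y
    rw [sq_le_sq]
    have := ((LipschitzWith.id.const_min a).const_max (-a)).dist_le_mul x y
    simpa [Real.dist_eq] using this
  rw [EuclideanSpace.norm_eq, EuclideanSpace.norm_eq]
  apply Real.sqrt_le_sqrt
  simp only [Fin.sum_univ_two, Real.norm_eq_abs, sq_abs, planeClamp]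
  exact add_le_add (h _ _) (h _ _)

theorem norm_planeClamp_le {a : ℝ} (ha : 0 ≤ a) (z : Plane) : ‖planeClamp a z‖ ≤ 2 * a := by
  have h : ∀ x : ℝ, max (-a) (min a x) ^ 2 ≤ a ^ 2 := by
    intro x
    rw [sq_le_sq, abs_of_nonneg ha, abs_le]
    exact ⟨le_max_left _ _, max_le (by linarith) (min_le_left _ _)⟩
  refine abs_le_of_sq_le_sq' ?_ (by positivity) |>.2
  rw [EuclideanSpace.real_norm_sq_eq, Fin.sum_univ_two]
  have := add_le_add (h (z 0)) (h (z 1))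
  simp only [planeClamp]
  refine this.trans ?_
  nlinarith

theorem planeClamp_eq_self {a : ℝ} {z : Plane} (hz : ‖z‖ ≤ a) : planeClamp a z = z := by
  have h : ∀ i, max (-a) (min a (z i)) = z i := by
    intro i
    have := abs_le.mp ((PiLp.norm_apply_le z i).trans hz)
    rw [min_eq_right this.2, max_eq_right this.1]
  ext i
  fin_cases i
  · exact h 0
  · exact h 1

/-- Existence, on any compact time interval, of a pair position-velocity that satisfies the
equations of motion while it is near the origin. -/
theorem exists_hasDerivWithinAt_of_norm_le {A k α : ℝ} (hA : 0 < A) (hk : 0 < k) (hα : 1 < α)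
    (ω : ℝ) {T D : ℝ} (hT : 0 ≤ T) {d : ℝ → Plane} (hd : ContinuousOn d (Icc 0 T))
    (hD : ∀ t ∈ Icc 0 T, ‖d t‖ ≤ D) (q₀ v₀ : Plane) :
    ∃ q v : ℝ → Plane, q 0 = q₀ ∧ v 0 = v₀ ∧
      ContinuousOn q (Icc 0 T) ∧ ContinuousOn v (Icc 0 T) ∧
      ∀ t ∈ Icc 0 T, ‖q t‖ ≤ 1 / 8 → ‖v t‖ ≤ 2 →
        HasDerivWithinAt q (v t - d t) (Icc 0 T) t ∧
        HasDerivWithinAt v (repulsion A α (q t - circleDir (ω * t)) - k • v t) (Icc 0 T) t := by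
  obtain ⟨C, hC, hbd, hlip⟩ := exists_repulsion_bounded_lipschitz hA (show 0 < α by linarith)
  have hD0 : 0 ≤ D := (norm_nonneg _).trans (hD 0 (left_mem_Icc.mpr hT))
  let f : ℝ → Plane × Plane → Plane × Plane := fun t x =>
    (planeClamp 2 x.2 - d t,
      repulsion A α (planeClamp (1 / 8) x.1 - circleDir (ω * t)) - k • planeClamp 2 x.2)
  have hann : ∀ t (z : Plane), 1 / 2 ≤ ‖planeClamp (1 / 8) z - circleDir (ω * t)‖ ∧
      ‖planeClamp (1 / 8) z - circleDir (ω * t)‖ ≤ 2 := by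
    intro t z
    have h1 := norm_planeClamp_le (a := 1 / 8) (by norm_num) z
    have h2 := norm_circleDir (ω * t)
    constructor
    · have := norm_sub_norm_le (circleDir (ω * t)) (planeClamp (1 / 8) z)
      rw [norm_sub_rev]; linarith
    · have := norm_sub_le (planeClamp (1 / 8) z) (circleDir (ω * t))
      linarith
  have hsol := exists_hasDerivWithinAt_of_bounded_lipschitz (f := f) hT
    (K := .mk (1 + C + k) (by positivity)) (L := .mk (4 + D + C + k * 4) (by positivity))
    (fun t ht => ?_) (fun z => ?_) (fun t ht z => ?_) (q₀, v₀)
  · obtain ⟨x, hx0, hx⟩ := hsol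
    have hxc : ContinuousOn x (Icc 0 T) := fun t ht => (hx t ht).continuousWithinAt
    refine ⟨fun t => (x t).1, fun t => (x t).2, by simp [hx0], by simp [hx0], hxc.fst, hxc.snd, ?_⟩
    intro t ht h1 h2
    have e1 := (hx t ht).hasFDerivWithinAt.fst.hasDerivWithinAt
    have e2 := (hx t ht).hasFDerivWithinAt.snd.hasDerivWithinAt
    simp only [f, planeClamp_eq_self h1, planeClamp_eq_self h2] at e1 e2
    constructor
    · simpa using e1
    · simpa using e2
  · refine LipschitzWith.of_dist_le_mul fun z z' => ?_
    have h1 : ‖z.1 - z'.1‖ ≤ ‖z - z'‖ := norm_fst_le (z - z')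
    have h2 : ‖z.2 - z'.2‖ ≤ ‖z - z'‖ := norm_snd_le (z - z')
    have h3 := (norm_planeClamp_sub_le (1 / 8) z.1 z'.1).trans h1
    have h4 := (norm_planeClamp_sub_le 2 z.2 z'.2).trans h2
    have h0 : 0 ≤ ‖z - z'‖ := norm_nonneg _
    rw [dist_eq_norm, dist_eq_norm, Prod.norm_def, NNReal.coe_mk]
    refine max_le ?_ ?_
    · simp only [f, Prod.fst_sub, sub_sub_sub_cancel_right]
      nlinarith
    · have h5 := hlip _ _ (hann t z.1).1 (hann t z.1).2 (hann t z'.1).1 (hann t z'.1).2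
      rw [sub_sub_sub_cancel_right] at h5
      have h6 : ‖k • (planeClamp 2 z.2 - planeClamp 2 z'.2)‖ ≤ k * ‖z - z'‖ := by
        rw [norm_smul, Real.norm_of_nonneg hk.le]; gcongr
      have h7 := h5.trans (mul_le_mul_of_nonneg_left h3 hC)
      have e : (f t z - f t z').2 =
          (repulsion A α (planeClamp (1 / 8) z.1 - circleDir (ω * t)) -
            repulsion A α (planeClamp (1 / 8) z'.1 - circleDir (ω * t))) -
          k • (planeClamp 2 z.2 - planeClamp 2 z'.2) := by
        simp only [f, Prod.snd_sub]; module
      rw [e]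
      refine (norm_sub_le _ _).trans ?_
      linarith
  · have hcd : Continuous fun t => circleDir (ω * t) :=
      continuous_circleDir.comp (continuous_const_mul ω)
    have hy : Continuous fun t => planeClamp (1 / 8) z.1 - circleDir (ω * t) :=
      continuous_const.sub hcd
    refine (continuousOn_const.sub hd).prodMk (ContinuousOn.sub ?_ continuousOn_const)
    simp only [repulsion_eq]
    refine ((continuous_const.mul ((hy.norm.pow 2).rpow_const fun t => Or.inl ?_)).smul
      hy).continuousOn
    exact (pow_pos (lt_of_lt_of_le one_half_pos (hann t z.1).1) 2).ne'
  · rw [NNReal.coe_mk, Prod.norm_def]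
    have h4 := norm_planeClamp_le (a := 2) (by norm_num) z.2
    have h6 : ‖k • planeClamp 2 z.2‖ ≤ k * 4 := by
      rw [norm_smul, Real.norm_of_nonneg hk.le]; gcongr; linarith
    have h8 : 0 ≤ k * 4 := by positivity
    refine max_le ?_ ?_
    · refine (norm_sub_le _ _).trans ?_
      linarith [hD t ht]
    · refine (norm_sub_le _ _).trans ?_
      linarith [hbd _ (hann t z.1).1 (hann t z.1).2]

theorem mapsTo_const_mul_Icc {δ : ℝ} (hδ : 0 < δ) :
    MapsTo (fun τ => δ * τ) (Icc 0 (1 / δ)) (Icc 0 1) := fun _ hτ =>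
  ⟨mul_nonneg hδ.le hτ.1, (le_div_iff₀' hδ).mp hτ.2⟩

/-- A continuously differentiable curve on `[0, 1]`, run at speed `δ`. -/
theorem hasDerivWithinAt_comp_const_mul {γ : ℝ → Plane} (hγ : ContDiffOn ℝ 1 γ (Icc 0 1)) {δ : ℝ}
    (hδ : 0 < δ) {t : ℝ} (ht : t ∈ Icc 0 (1 / δ)) :
    HasDerivWithinAt (fun τ => γ (δ * τ)) (δ • derivWithin γ (Icc 0 1) (δ * t))
      (Icc 0 (1 / δ)) t := by
  have hmaps := mapsTo_const_mul_Icc hδ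
  have h1 := ((hγ.differentiableOn one_ne_zero) _ (hmaps ht)).hasDerivWithinAt
  have h2 : HasDerivWithinAt (fun τ => δ * τ) δ (Icc 0 (1 / δ)) t := by
    simpa using ((hasDerivAt_id t).const_mul δ).hasDerivWithinAt
  exact h1.scomp t h2 hmaps

theorem hasDerivWithinAt_leaderPath {γ : ℝ → Plane} (hγ : ContDiffOn ℝ 1 γ (Icc 0 1)) (ω : ℝ)
    {δ : ℝ} (hδ : 0 < δ) {t : ℝ} (ht : t ∈ Icc 0 (1 / δ)) :
    HasDerivWithinAt (fun τ => circleDir (ω * τ) + γ (δ * τ)) (oscillatoryInput ω δ γ t)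
      (Icc 0 (1 / δ)) t := by
  refine ((hasDerivAt_circleDir ω t).hasDerivWithinAt.add
    (hasDerivWithinAt_comp_const_mul hγ hδ ht)).congr_deriv ?_
  rw [oscillatoryInput]
  congr 1
  ext i; fin_cases i <;> simp [circleTangent]

/-- The leader of any solution with the oscillatory input moves on the circle around `γ`. -/
theorem IsLFSolution.leader_eq {A k α : ℝ} {N : ℕ} {s₀ : LFState N} {ω δ : ℝ} {γ : ℝ → Plane}
    {s : ℝ → LFState N} (hs : IsLFSolution A k α s₀ (1 / δ) (oscillatoryInput ω δ γ) s)
    (hγ : ContDiffOn ℝ 1 γ (Icc 0 1)) (hγ0 : γ 0 = 0) (hl : s₀.leader = !₂[1, 0]) (hδ : 0 < δ) :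
    ∀ t ∈ Icc 0 (1 / δ), (s t).leader = circleDir (ω * t) + γ (δ * t) := by
  have hd : ∀ t ∈ Icc 0 (1 / δ), HasDerivWithinAt
      (fun τ => (s τ).leader - (circleDir (ω * τ) + γ (δ * τ))) 0 (Icc 0 (1 / δ)) t := by
    intro t ht
    exact ((hs.leader_deriv t ht).sub (hasDerivWithinAt_leaderPath hγ ω hδ ht)).congr_deriv
      (sub_self _)
  have huniq : UniqueDiffOn ℝ (Icc 0 (1 / δ)) := uniqueDiffOn_Icc (by positivity)
  have := constant_of_derivWithin_zero (fun t ht => (hd t ht).differentiableWithinAt)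
    (fun t ht => (hd t (Ico_subset_Icc_self ht)).derivWithin (huniq t (Ico_subset_Icc_self ht)))
  intro t ht
  have h := this t ht
  rw [hs.initial, hl, mul_zero, mul_zero, hγ0] at h
  have h0 : (!₂[1, 0] : Plane) - (circleDir 0 + 0) = 0 := by simp [circleDir]
  rwa [h0, sub_eq_zero] at h

theorem norm_pair_le_norm_quadruple (x y : Plane) :
    ‖x‖ ≤ ‖!₂[x 0, x 1, y 0, y 1]‖ ∧ ‖y‖ ≤ ‖!₂[x 0, x 1, y 0, y 1]‖ := by
  simp only [EuclideanSpace.norm_eq, Fin.sum_univ_two, Fin.sum_univ_four]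
  constructor <;> apply Real.sqrt_le_sqrt <;> simp <;> nlinarith [sq_nonneg (x 0), sq_nonneg (x 1),
    sq_nonneg (y 0), sq_nonneg (y 1)]

theorem exists_inputConfines_oscillatoryInput {A k α : ℝ} (hA : 0 < A) (hk : 0 < k)
    (hα : 1 < α) :
    ∃ r : ℝ, 0 < r ∧ ∀ (N : ℕ) (s₀ : LFState N), s₀.leader = !₂[1, 0] →
      (∀ i, ‖!₂[s₀.pos i 0, s₀.pos i 1, s₀.vel i 0, s₀.vel i 1]‖ < r) →
      ∀ γ : ℝ → Plane, ContDiffOn ℝ 1 γ (Icc 0 1) → γ 0 = 0 →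
        ∃ ω₁ : ℝ, 0 < ω₁ ∧ ∃ δ₁ : ℝ, 0 < δ₁ ∧ ∀ ω δ : ℝ, ω₁ < ω → 0 < δ → δ < δ₁ →
          InputConfines A k α s₀ 1 γ (1 / δ) (oscillatoryInput ω δ γ) := by
  obtain ⟨r, hr, hmain⟩ := exists_forall_norm_le_of_hasDerivWithinAt hA hk hα
  refine ⟨r, hr, fun N s₀ hl hs₀ γ hγ hγ0 => ?_⟩
  have hdc : ContinuousOn (derivWithin γ (Icc 0 1)) (Icc 0 1) :=
    hγ.continuousOn_derivWithin (uniqueDiffOn_Icc one_pos) le_rfl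
  obtain ⟨M, hM⟩ := isCompact_Icc.exists_bound_of_continuousOn hdc
  have hM0 : 0 ≤ M := (norm_nonneg _).trans (hM 0 (by simp))
  obtain ⟨ω₁, hω₁, δ₁, hδ₁, hconf⟩ := hmain M hM0
  refine ⟨ω₁, hω₁, δ₁, hδ₁, fun ω δ hω hδ hδlt => ?_⟩
  have hT : 0 ≤ 1 / δ := by positivity
  have hmaps := mapsTo_const_mul_Icc hδ
  set d : ℝ → Plane := fun t => δ • derivWithin γ (Icc 0 1) (δ * t) with hddef
  have hdcont : ContinuousOn d (Icc 0 (1 / δ)) :=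
    (hdc.comp (continuous_const_mul δ).continuousOn hmaps).const_smul δ
  have hd : ∀ t ∈ Icc 0 (1 / δ), ‖d t‖ ≤ δ * M := by
    intro t ht
    rw [hddef, norm_smul, Real.norm_of_nonneg hδ.le]
    gcongr
    exact hM _ (hmaps ht)
  have hcurve := fun t ht => hasDerivWithinAt_comp_const_mul hγ hδ (t := t) ht
  have hcollision : ∀ (t : ℝ) (q : Plane), ‖q‖ ≤ 1 / 8 → q ≠ circleDir (ω * t) := by
    rintro t q hq rfl
    rw [norm_circleDir] at hq
    norm_num at hq
  have hstart : ∀ i, ‖s₀.pos i‖ < r ∧ ‖s₀.vel i‖ < r := fun i =>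
    ⟨(norm_pair_le_norm_quadruple _ _).1.trans_lt (hs₀ i),
      (norm_pair_le_norm_quadruple _ _).2.trans_lt (hs₀ i)⟩
  constructor
  · choose q v hq0 hv0 hqc hvc hode using fun i : Fin N =>
      exists_hasDerivWithinAt_of_norm_le hA hk hα ω hT hdcont hd (s₀.pos i) (s₀.vel i)
    have hbound := fun i => hconf ω δ hω hδ hδlt (1 / δ) d (q i) (v i) hT hd
      (by rw [hq0]; exact (hstart i).1) (by rw [hv0]; exact (hstart i).2) (hqc i) (hvc i) (hode i)
    have hode' := fun i t ht => hode i t ht (hbound i t ht).1 (hbound i t ht).2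
    refine ⟨fun t => ⟨circleDir (ω * t) + γ (δ * t), fun i => q i t + γ (δ * t), fun i => v i t⟩,
      ?_, ?_, ?_, ?_, ?_⟩
    · simp only [mul_zero, hγ0, add_zero, hq0, hv0]
      have : circleDir 0 = s₀.leader := by rw [hl]; simp [circleDir]
      rw [this]
    · intro t ht i h
      exact hcollision t _ (hbound i t ht).1 (add_right_cancel h)
    · exact fun t ht => hasDerivWithinAt_leaderPath hγ ω hδ ht
    · intro t ht i
      exact ((hode' i t ht).1.add (hcurve t ht)).congr_deriv (sub_add_cancel _ _)
    · intro t ht i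
      refine (hode' i t ht).2.congr_deriv ?_
      simp only [add_sub_add_right_eq_sub]
  · intro s hs t ht
    have hleader := hs.leader_eq hγ hγ0 hl hδ
    have htT : t / (1 / δ) = δ * t := by field_simp
    rw [htT]
    constructor
    · intro i
      have hq : ∀ t ∈ Icc 0 (1 / δ), HasDerivWithinAt (fun τ => (s τ).pos i - γ (δ * τ))
          ((s t).vel i - d t) (Icc 0 (1 / δ)) t := fun t ht =>
        (hs.pos_deriv t ht i).sub (hcurve t ht)
      have hb := (hconf ω δ hω hδ hδlt (1 / δ) d (fun t => (s t).pos i - γ (δ * t))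
        (fun t => (s t).vel i) hT hd (by simpa [hs.initial, hγ0] using (hstart i).1)
        (by simpa [hs.initial] using (hstart i).2)
        (fun t ht => (hq t ht).continuousWithinAt)
        (fun t ht => (hs.vel_deriv t ht i).continuousWithinAt)
        (fun t ht _ _ => ⟨hq t ht, (hs.vel_deriv t ht i).congr_deriv (by
          rw [hleader t ht, sub_add_eq_sub_sub_swap])⟩) t ht).1
      rw [norm_sub_rev]
      exact hb.trans_lt (by norm_num)
    · rw [hleader t ht, sub_add_cancel_right, norm_neg, norm_circleDir]

theorem mainTheorem1 (A k α : ℝ) (hA : 0 < A) (hk : 0 < k) (hα : 1 < α) :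
    ∃ r : ℝ, 0 < r ∧ ∀ (N : ℕ) (s₀ : LFState N), s₀.leader = !₂[1, 0] →
      (∀ i, ‖!₂[s₀.pos i 0, s₀.pos i 1, s₀.vel i 0, s₀.vel i 1]‖ < r) →
      ∀ γ : ℝ → Plane, ContDiffOn ℝ 1 γ (Icc 0 1) → γ 0 = 0 →
        IsConfinementControllable A k α s₀ 1 γ ∧
        ∃ ω₁ : ℝ, 0 < ω₁ ∧ ∃ δ₁ : ℝ, 0 < δ₁ ∧ ∀ ω δ : ℝ, ω₁ < ω → 0 < δ → δ < δ₁ →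
          InputConfines A k α s₀ 1 γ (1 / δ) (oscillatoryInput ω δ γ) := by
  obtain ⟨r, hr, h⟩ := exists_inputConfines_oscillatoryInput hA hk hα
  refine ⟨r, hr, fun N s₀ hl hs₀ γ hγ hγ0 => ?_⟩
  obtain ⟨ω₁, hω₁, δ₁, hδ₁, hconf⟩ := h N s₀ hl hs₀ γ hγ hγ0
  exact ⟨⟨1 / (δ₁ / 2), by positivity, _,
    hconf (ω₁ + 1) (δ₁ / 2) (by linarith) (by positivity) (by linarith)⟩,
    ω₁, hω₁, δ₁, hδ₁, hconf⟩
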